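/- **Conventions.** All Banach spaces are real, $B_X$ is the closed unit ball of $X$, and an operator is a continuous linear map between Banach spaces. A subset of a Banach space is relatively weakly compact if its weak closure is weakly compact, and an operator $T:Y\to X$ is weakly compact if $T(B_Y)$ is relatively weakly compact. The projective tensor product $X_1\widehat{\otimes}_\pi X_2$ is the completion of the algebraic tensor product $X_1\otimes X_2$ with respect to the norm $$\|z\|=\sup\{|\tilde S(z)| : S:X_1\times X_2\to\mathbb{R} \text{ continuous bilinear},\ \|S\|\le 1\},$$ where $\tilde S$ is the linear functional on $X_1\otimes X_2$ with $\tilde S(x_1\otimes x_2)=S(x_1,x_2)$. For $C_i\subseteq X_i$ let $C_1\otimes C_2:=\{x_1\otimes x_2: x_1\in C_1,\ x_2\in C_2\}\subseteq X_1\widehat{\otimes}_\pi X_2$. For operators $T_i:Y_i\to X_i$, $T_1\otimes T_2: Y_1\widehat{\otimes}_\pi Y_2\to X_1\widehat{\otimes}_\pi X_2$ is the unique operator with $(T_1\otimes T_2)(y_1\otimes y_2)=T_1(y_1)\otimes T_2(y_2)$ for all $y_1\in Y_1$, $y_2\in Y_2$. For a subset $C$ of a Banach space, $\mathrm{aconv}(C)$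 is the absolutely convex hull of $C$, i.e. the set of all finite sums $\sum_j a_jx_j$ with $x_j\in C$, $a_j\in\mathbb{R}$ and $\sum_j|a_j|\le 1$ (so $\mathrm{aconv}(\emptyset)=\{0\}$). If $W$ is a non-empty bounded absolutely convex subset of a Banach space $X$, then for $n\ge 1$ let $|x|_n:=\inf\{t>0: x\in t(2^nW+2^{-n}B_X)\}$ for $x \in X$, and let $$X_W:=\Big\{x\in X:\ \sum_{n=1}^\infty|x|_n^2<\infty\Big\},\qquad \|x\|_{X_W}:=\Big(\sum_{n=1}^\infty|x|_n^2\Big)^{1/2},$$ which is a Banach space. The inclusion $J_W:X_W\to X$ is an operator, called the DFJP (Davis–Figiel–Johnson–Pełczyński) operator associated to $W$. **Proposition.** Let $X_1$ and $X_2$ be Banach spaces. For each $i\in\{1,2\}$ let $C_i\subseteq X_i$ be a bounded set and let $T_i:Y_i\to X_i$ be the DFJP operator associated to $W_i:=\mathrm{aconv}(C_i)\subseteq X_i$. Then $T_1\otimes T_2$ is weakly compact if and only if $C_1\otimes C_2$ is relatively weakly compact in $X_1\widehat{\otimes}_\pi X_2$. -/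

import Mathlib

open scoped TensorProduct Pointwise Topology

noncomputable section

/-! ### Weak compactness -/

/-- A set is relatively weakly compact if its closure in the weak topology is weakly compact. -/
def IsRelWeaklyCompact {X : Type*} [NormedAddCommGroup X] [NormedSpace ℝ X] (A : Set X) : Prop :=
  IsCompact (closure (toWeakSpace ℝ X '' A))

/-- An operator is weakly compact if it maps the closed unit ball to a relatively weakly compact
set. -/
def IsWeaklyCompactOp {X Y : Type*} [NormedAddCommGroup X] [NormedSpace ℝ X]
    [NormedAddCommGroup Y] [NormedSpace ℝ Y] (T : X →L[ℝ] Y) : Prop :=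
  IsRelWeaklyCompact (T '' Metric.closedBall (0 : X) 1)

/-! ### The projective tensor product -/

section ProjectiveTensor

/-- The algebraic tensor product of two normed spaces, as a type of its own: it is
going to carry the projective norm. -/
def AlgTensor (X Y : Type*) [NormedAddCommGroup X] [NormedSpace ℝ X]
    [NormedAddCommGroup Y] [NormedSpace ℝ Y] : Type _ := X ⊗[ℝ] Y

variable {X Y X₁ X₂ Y₁ Y₂ : Type*}
  [NormedAddCommGroup X] [NormedSpace ℝ X] [NormedAddCommGroup Y] [NormedSpace ℝ Y]
  [NormedAddCommGroup X₁] [NormedSpace ℝ X₁] [NormedAddCommGroup X₂] [NormedSpace ℝ X₂]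
  [NormedAddCommGroup Y₁] [NormedSpace ℝ Y₁] [NormedAddCommGroup Y₂] [NormedSpace ℝ Y₂]

instance AlgTensor.instAddCommGroup : AddCommGroup (AlgTensor X Y) :=
  inferInstanceAs (AddCommGroup (X ⊗[ℝ] Y))

instance AlgTensor.instModule : Module ℝ (AlgTensor X Y) :=
  inferInstanceAs (Module ℝ (X ⊗[ℝ] Y))

/-- The linear functional on the algebraic tensor product induced by a continuous bilinear
functional: `x ⊗ y ↦ S x y`. -/
def AlgTensor.functional (S : X →L[ℝ] Y →L[ℝ] ℝ) : AlgTensor X Y →ₗ[ℝ] ℝ :=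
  (TensorProduct.lift ((ContinuousLinearMap.coeLM ℝ).comp S.toLinearMap) : X ⊗[ℝ] Y →ₗ[ℝ] ℝ)

/-- The projective norm: the supremum of `|S̃ z|` over the unit ball of the space of continuous
bilinear functionals. -/
instance AlgTensor.instNorm : Norm (AlgTensor X Y) :=
  ⟨fun z => ⨆ S : {S : X →L[ℝ] Y →L[ℝ] ℝ // ‖S‖ ≤ 1}, |AlgTensor.functional S.1 z|⟩

theorem AlgTensor.norm_def (z : AlgTensor X Y) :
    ‖z‖ = ⨆ S : {S : X →L[ℝ] Y →L[ℝ] ℝ // ‖S‖ ≤ 1}, |AlgTensor.functional S.1 z| := rfl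

theorem AlgTensor.exists_bound (z : AlgTensor X Y) :
    ∃ c : ℝ, 0 ≤ c ∧ ∀ S : X →L[ℝ] Y →L[ℝ] ℝ, |AlgTensor.functional S z| ≤ ‖S‖ * c := by
  refine TensorProduct.induction_on (motive := fun z : X ⊗[ℝ] Y => ∃ c : ℝ, 0 ≤ c ∧
    ∀ S : X →L[ℝ] Y →L[ℝ] ℝ, |AlgTensor.functional S z| ≤ ‖S‖ * c) z ?_ ?_ ?_
  · exact ⟨0, le_rfl, fun S => by
      have : AlgTensor.functional S (0 : X ⊗[ℝ] Y) = 0 := map_zero (AlgTensor.functional S)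
      rw [this]; simp⟩
  · intro x y
    refine ⟨‖x‖ * ‖y‖, by positivity, fun S => ?_⟩
    have : AlgTensor.functional S (x ⊗ₜ[ℝ] y) = S x y := rfl
    rw [this, ← mul_assoc]
    exact S.le_opNorm₂ x y
  · rintro a b ⟨c, hc, h⟩ ⟨d, hd, k⟩
    refine ⟨c + d, by positivity, fun S => ?_⟩
    have : AlgTensor.functional S (a + b : X ⊗[ℝ] Y)
        = AlgTensor.functional S a + AlgTensor.functional S b :=
      map_add (AlgTensor.functional S) a b
    rw [this, mul_add]
    exact (abs_add_le _ _).trans (add_le_add (h S) (k S))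

theorem AlgTensor.bddAbove (z : AlgTensor X Y) :
    BddAbove (Set.range fun S : {S : X →L[ℝ] Y →L[ℝ] ℝ // ‖S‖ ≤ 1} =>
      |AlgTensor.functional S.1 z|) := by
  obtain ⟨c, hc, h⟩ := AlgTensor.exists_bound z
  refine ⟨c, ?_⟩
  rintro _ ⟨S, rfl⟩
  exact (h S.1).trans (mul_le_of_le_one_left hc S.2)

theorem AlgTensor.core : SeminormedSpace.Core ℝ (AlgTensor X Y) where
  norm_nonneg z := Real.iSup_nonneg fun _ => abs_nonneg _
  norm_smul c z := by
    simp only [AlgTensor.norm_def, map_smul, smul_eq_mul, abs_mul, Real.norm_eq_abs]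
    exact (Real.mul_iSup_of_nonneg (abs_nonneg c) _).symm
  norm_triangle z w := by
    have : Nonempty {S : X →L[ℝ] Y →L[ℝ] ℝ // ‖S‖ ≤ 1} := ⟨⟨0, ContinuousLinearMap.opNorm_zero.trans_le zero_le_one⟩⟩
    refine ciSup_le fun S => ?_
    rw [map_add]
    exact (abs_add_le _ _).trans
      (add_le_add (le_ciSup (AlgTensor.bddAbove z) S) (le_ciSup (AlgTensor.bddAbove w) S))

instance AlgTensor.instSeminormedAddCommGroup : SeminormedAddCommGroup (AlgTensor X Y) :=
  SeminormedAddCommGroup.ofCore AlgTensor.core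

instance AlgTensor.instNormedSpace : NormedSpace ℝ (AlgTensor X Y) where
  norm_smul_le c z := (AlgTensor.core.norm_smul c z).le

/-- The projective tensor product: the completion of the algebraic tensor product with respect
to the projective norm. -/
abbrev ProjTensor (X Y : Type*) [NormedAddCommGroup X] [NormedSpace ℝ X]
    [NormedAddCommGroup Y] [NormedSpace ℝ Y] : Type _ :=
  UniformSpace.Completion (AlgTensor X Y)

/-- The elementary tensor `x ⊗ y`. -/
def ProjTensor.tmul (x : X) (y : Y) : ProjTensor X Y :=
  UniformSpace.Completion.coe' (α := AlgTensor X Y) (x ⊗ₜ[ℝ] y : X ⊗[ℝ] Y)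

/-- The set `C₁ ⊗ C₂` of all `x ⊗ y` with `x ∈ C₁` and `y ∈ C₂`. -/
def ProjTensor.setTmul (C₁ : Set X) (C₂ : Set Y) : Set (ProjTensor X Y) :=
  Set.image2 ProjTensor.tmul C₁ C₂

/-- The algebraic tensor product of two operators. -/
def AlgTensor.mapₗ (T₁ : Y₁ →L[ℝ] X₁) (T₂ : Y₂ →L[ℝ] X₂) :
    AlgTensor Y₁ Y₂ →ₗ[ℝ] AlgTensor X₁ X₂ :=
  (TensorProduct.map T₁.toLinearMap T₂.toLinearMap : Y₁ ⊗[ℝ] Y₂ →ₗ[ℝ] X₁ ⊗[ℝ] X₂)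

theorem AlgTensor.functional_le (S : X →L[ℝ] Y →L[ℝ] ℝ) (z : AlgTensor X Y) :
    |AlgTensor.functional S z| ≤ ‖S‖ * ‖z‖ := by
  rcases eq_or_ne S 0 with rfl | hS
  · obtain ⟨c, -, h⟩ := AlgTensor.exists_bound z
    refine (h 0).trans ?_
    rw [ContinuousLinearMap.opNorm_zero, zero_mul, zero_mul]
  have hS' : 0 < ‖S‖ := (norm_pos_iff (a := S)).2 hS
  have h := le_ciSup (AlgTensor.bddAbove z) ⟨‖S‖⁻¹ • S, by
    refine (ContinuousLinearMap.opNorm_smul_le _ S).trans ?_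
    rw [Real.norm_of_nonneg (inv_nonneg.2 hS'.le), inv_mul_cancel₀ hS'.ne']⟩
  have h2 : AlgTensor.functional (‖S‖⁻¹ • S) z = ‖S‖⁻¹ * AlgTensor.functional S z := by
    refine TensorProduct.induction_on (motive := fun z : X ⊗[ℝ] Y =>
      AlgTensor.functional (‖S‖⁻¹ • S) z = ‖S‖⁻¹ * AlgTensor.functional S z) z ?_ ?_ ?_
    · have k (S : X →L[ℝ] Y →L[ℝ] ℝ) : AlgTensor.functional S (0 : X ⊗[ℝ] Y) = 0 :=
        map_zero (AlgTensor.functional S)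
      rw [k, k, mul_zero]
    · intro x y
      rfl
    · intro a b ha hb
      have k (S : X →L[ℝ] Y →L[ℝ] ℝ) : AlgTensor.functional S (a + b : X ⊗[ℝ] Y)
        = AlgTensor.functional S a + AlgTensor.functional S b :=
        map_add (AlgTensor.functional S) a b
      rw [k, k, ha, hb, mul_add]
  simp only [h2, abs_mul, abs_inv, abs_of_pos hS'] at h
  rwa [inv_mul_le_iff₀ hS'] at h

theorem AlgTensor.norm_mapₗ_le (T₁ : Y₁ →L[ℝ] X₁) (T₂ : Y₂ →L[ℝ] X₂) (z : AlgTensor Y₁ Y₂) :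
    ‖AlgTensor.mapₗ T₁ T₂ z‖ ≤ ‖T₁‖ * ‖T₂‖ * ‖z‖ := by
  have : Nonempty {S : X₁ →L[ℝ] X₂ →L[ℝ] ℝ // ‖S‖ ≤ 1} := ⟨⟨0, ContinuousLinearMap.opNorm_zero.trans_le zero_le_one⟩⟩
  refine ciSup_le fun S => ?_
  have h : AlgTensor.functional S.1 (AlgTensor.mapₗ T₁ T₂ z)
      = AlgTensor.functional (S.1.bilinearComp T₁ T₂) z := by
    have : (AlgTensor.functional S.1).comp (AlgTensor.mapₗ T₁ T₂)
        = AlgTensor.functional (S.1.bilinearComp T₁ T₂) :=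
      TensorProduct.ext' (fun x y => rfl)
    exact LinearMap.congr_fun this z
  rw [h]
  refine (AlgTensor.functional_le _ z).trans (mul_le_mul_of_nonneg_right ?_ (norm_nonneg z))
  refine ContinuousLinearMap.opNorm_le_bound₂ _ (by positivity) fun x y => ?_
  calc ‖S.1 (T₁ x) (T₂ y)‖ ≤ ‖S.1‖ * ‖T₁ x‖ * ‖T₂ y‖ := S.1.le_opNorm₂ _ _
    _ ≤ 1 * (‖T₁‖ * ‖x‖) * (‖T₂‖ * ‖y‖) := by
      gcongr
      · exact S.2
      · exact T₁.le_opNorm x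
      · exact T₂.le_opNorm y
    _ = ‖T₁‖ * ‖T₂‖ * ‖x‖ * ‖y‖ := by ring

/-- The algebraic tensor product of two operators, as a continuous map. -/
def AlgTensor.map (T₁ : Y₁ →L[ℝ] X₁) (T₂ : Y₂ →L[ℝ] X₂) :
    AlgTensor Y₁ Y₂ →L[ℝ] AlgTensor X₁ X₂ :=
  (AlgTensor.mapₗ T₁ T₂).mkContinuous (‖T₁‖ * ‖T₂‖) (AlgTensor.norm_mapₗ_le T₁ T₂)

/-- The projective tensor product `T₁ ⊗ T₂` of two operators: the continuous extension
to the completions of the algebraic tensor product of the operators. -/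
def ProjTensor.map (T₁ : Y₁ →L[ℝ] X₁) (T₂ : Y₂ →L[ℝ] X₂) :
    ProjTensor Y₁ Y₂ →L[ℝ] ProjTensor X₁ X₂ :=
  (UniformSpace.Completion.toComplL.comp (AlgTensor.map T₁ T₂)).extend
    (UniformSpace.Completion.toComplL : AlgTensor Y₁ Y₂ →L[ℝ] ProjTensor Y₁ Y₂)

theorem ProjTensor.map_tmul (T₁ : Y₁ →L[ℝ] X₁) (T₂ : Y₂ →L[ℝ] X₂) (y₁ : Y₁) (y₂ : Y₂) :
    ProjTensor.map T₁ T₂ (ProjTensor.tmul y₁ y₂) = ProjTensor.tmul (T₁ y₁) (T₂ y₂) :=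
  ContinuousLinearMap.extend_eq (UniformSpace.Completion.toComplL.comp (AlgTensor.map T₁ T₂))
    (e := (UniformSpace.Completion.toComplL : AlgTensor Y₁ Y₂ →L[ℝ] ProjTensor Y₁ Y₂))
    UniformSpace.Completion.denseRange_coe
    (UniformSpace.Completion.isUniformInducing_coe _) (y₁ ⊗ₜ[ℝ] y₂ : Y₁ ⊗[ℝ] Y₂)

end ProjectiveTensor

/-! ### The Davis-Figiel-Johnson-Pełczyński construction -/

section DFJP

/-- A bounded absolutely convex set (an absolutely convex set contains `0`). -/
structure BddAbsConvex (X : Type*) [NormedAddCommGroup X] [NormedSpace ℝ X] where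
  carrier : Set X
  zero_mem : (0 : X) ∈ carrier
  absConvex : AbsConvex ℝ carrier
  isBounded : Bornology.IsBounded carrier

variable {X : Type*} [NormedAddCommGroup X] [NormedSpace ℝ X]

/-- The absolutely convex hull of a bounded set, that is, the set of all finite sums
`∑ aᵢ • xᵢ` with `xᵢ ∈ C` and `∑ |aᵢ| ≤ 1`. The point `0` is inserted only for the sake of
`C = ∅`, whose hull is `{0}`; see `aconv_carrier`. -/
def aconv (C : Set X) (hC : Bornology.IsBounded C) : BddAbsConvex X where
  carrier := absConvexHull ℝ (insert 0 C)
  zero_mem := subset_absConvexHull (Set.mem_insert 0 C)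
  absConvex := absConvex_absConvexHull
  isBounded := by
    obtain ⟨r, hr⟩ := (hC.insert 0).subset_closedBall (0 : X)
    exact Metric.isBounded_closedBall.subset
      (absConvexHull_min hr ⟨balanced_closedBall_zero, convex_closedBall 0 r⟩)

theorem aconv_carrier {C : Set X} (hC : Bornology.IsBounded C) (hne : C.Nonempty) :
    (aconv C hC).carrier = absConvexHull ℝ C := by
  apply subset_antisymm
  · refine absConvexHull_min (Set.insert_subset ?_ subset_absConvexHull) absConvex_absConvexHull
    exact balanced_absConvexHull.zero_mem (absConvexHull_nonempty.2 hne)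
  · exact absConvexHull_mono (Set.subset_insert 0 C)

namespace BddAbsConvex

variable (W : BddAbsConvex X)

/-- `W_n = 2^n W + 2^{-n} B_X`. -/
def nbhd (n : ℕ) : Set X :=
  (2 : ℝ) ^ n • W.carrier + ((2 : ℝ) ^ n)⁻¹ • Metric.closedBall (0 : X) 1

/-- `|x|_n`, the Minkowski functional of `W_n`. -/
def seminormAt (n : ℕ) (x : X) : ℝ := gauge (W.nbhd n) x

theorem convex_nbhd (n : ℕ) : Convex ℝ (W.nbhd n) :=
  (W.absConvex.2.smul _).add ((convex_closedBall 0 1).smul _)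

theorem balanced_nbhd (n : ℕ) : Balanced ℝ (W.nbhd n) :=
  (W.absConvex.1.smul _).add (balanced_closedBall_zero.smul _)

theorem nbhd_mem_nhds (n : ℕ) : W.nbhd n ∈ 𝓝 (0 : X) := by
  have h : ((2 : ℝ) ^ n)⁻¹ • Metric.closedBall (0 : X) 1 ∈ 𝓝 (0 : X) :=
    (set_smul_mem_nhds_zero_iff (by positivity)).2 (Metric.closedBall_mem_nhds 0 one_pos)
  refine Filter.mem_of_superset h fun x hx => ?_
  exact Set.mem_add.2 ⟨0, Set.mem_smul_set.2 ⟨0, W.zero_mem, smul_zero _⟩, x, hx, zero_add x⟩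

theorem absorbent_nbhd (n : ℕ) : Absorbent ℝ (W.nbhd n) :=
  absorbent_nhds_zero (W.nbhd_mem_nhds n)

theorem isBounded_nbhd (n : ℕ) : Bornology.IsBounded (W.nbhd n) :=
  (W.isBounded.smul₀ _).add (Metric.isBounded_closedBall.smul₀ _)

theorem seminormAt_nonneg (n : ℕ) (x : X) : 0 ≤ W.seminormAt n x := gauge_nonneg x

theorem seminormAt_zero (n : ℕ) : W.seminormAt n 0 = 0 := gauge_zero

theorem seminormAt_add_le (n : ℕ) (x y : X) :
    W.seminormAt n (x + y) ≤ W.seminormAt n x + W.seminormAt n y :=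
  gauge_add_le (W.convex_nbhd n) (W.absorbent_nbhd n) x y

theorem seminormAt_smul (n : ℕ) (c : ℝ) (x : X) :
    W.seminormAt n (c • x) = |c| * W.seminormAt n x :=
  gauge_smul (W.balanced_nbhd n) c x

theorem exists_norm_le (n : ℕ) : ∃ r : ℝ, 0 < r ∧ ∀ x, ‖x‖ ≤ r * W.seminormAt n x := by
  obtain ⟨r, hr, h⟩ := (W.isBounded_nbhd n).subset_closedBall_lt 0 (0 : X)
  refine ⟨r, hr, fun x => ?_⟩
  have := le_gauge_of_subset_closedBall (W.absorbent_nbhd n) hr.le h (x := x)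
  rwa [div_le_iff₀ hr, mul_comm] at this

theorem minkowski {x y : X} (hx : Summable fun n : ℕ => W.seminormAt (n + 1) x ^ 2)
    (hy : Summable fun n : ℕ => W.seminormAt (n + 1) y ^ 2) :
    (Summable fun n : ℕ => W.seminormAt (n + 1) (x + y) ^ 2) ∧
    √(∑' n : ℕ, W.seminormAt (n + 1) (x + y) ^ 2) ≤
      √(∑' n : ℕ, W.seminormAt (n + 1) x ^ 2) + √(∑' n : ℕ, W.seminormAt (n + 1) y ^ 2) := by
  have h := Real.Lp_add_le_tsum_of_nonneg (p := 2) one_le_two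
    (fun n : ℕ => W.seminormAt_nonneg (n + 1) x) (fun n : ℕ => W.seminormAt_nonneg (n + 1) y)
    (by simpa using hx) (by simpa using hy)
  simp only [Real.rpow_ofNat, ← Real.sqrt_eq_rpow] at h
  have hle (n : ℕ) : W.seminormAt (n + 1) (x + y) ^ 2
      ≤ (W.seminormAt (n + 1) x + W.seminormAt (n + 1) y) ^ 2 :=
    pow_le_pow_left₀ (W.seminormAt_nonneg _ _) (W.seminormAt_add_le _ x y) 2
  have hs := Summable.of_nonneg_of_le (fun n => sq_nonneg _) hle h.1
  exact ⟨hs, (Real.sqrt_le_sqrt (hs.tsum_le_tsum hle h.1)).trans h.2⟩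

/-- `X_W = {x : ∑_{n ≥ 1} |x|_n ^ 2 < ∞}`. -/
def submodule : Submodule ℝ X where
  carrier := {x | Summable fun n : ℕ => W.seminormAt (n + 1) x ^ 2}
  zero_mem' := by simp [seminormAt_zero]
  add_mem' hx hy := (W.minkowski hx hy).1
  smul_mem' c x hx := by
    simp only [Set.mem_ofPred_eq, seminormAt_smul, mul_pow]
    exact Summable.mul_left _ hx

/-- The space `X_W` as a type of its own, carrying its own norm (and not that of `X`). -/
def Space : Type _ := W.submodule

instance : AddCommGroup W.Space := inferInstanceAs (AddCommGroup W.submodule)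

instance : Module ℝ W.Space := inferInstanceAs (Module ℝ W.submodule)

/-- The inclusion of `X_W` in `X`, as a linear map. -/
def incl : W.Space →ₗ[ℝ] X := W.submodule.subtype

theorem incl_injective : Function.Injective W.incl := W.submodule.injective_subtype

theorem summable_incl (x : W.Space) :
    Summable fun n : ℕ => W.seminormAt (n + 1) (W.incl x) ^ 2 := x.2

/-- `‖x‖ = (∑_{n ≥ 1} |x|_n ^ 2) ^ (1/2)` on `X_W`. -/
instance : Norm W.Space := ⟨fun x => √(∑' n : ℕ, W.seminormAt (n + 1) (W.incl x) ^ 2)⟩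

theorem norm_def (x : W.Space) :
    ‖x‖ = √(∑' n : ℕ, W.seminormAt (n + 1) (W.incl x) ^ 2) := rfl

theorem seminormAt_le_norm (x : W.Space) (n : ℕ) : W.seminormAt (n + 1) (W.incl x) ≤ ‖x‖ :=
  Real.le_sqrt_of_sq_le ((W.summable_incl x).le_tsum n fun _ _ => sq_nonneg _)

theorem exists_norm_incl_le : ∃ r : ℝ, 0 < r ∧ ∀ x : W.Space, ‖W.incl x‖ ≤ r * ‖x‖ := by
  obtain ⟨r, hr, h⟩ := W.exists_norm_le 1
  exact ⟨r, hr, fun x => (h _).trans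
    (mul_le_mul_of_nonneg_left (W.seminormAt_le_norm x 0) hr.le)⟩

theorem core : NormedSpace.Core ℝ W.Space where
  norm_nonneg x := Real.sqrt_nonneg _
  norm_smul c x := by
    simp only [norm_def, map_smul, seminormAt_smul, mul_pow, tsum_mul_left, sq_abs]
    rw [Real.sqrt_mul (sq_nonneg c), Real.sqrt_sq_eq_abs, Real.norm_eq_abs]
  norm_triangle x y := by
    simp only [norm_def, map_add]
    exact (W.minkowski (W.summable_incl x) (W.summable_incl y)).2
  norm_eq_zero_iff x := by
    constructor
    · intro hx
      obtain ⟨r, -, h⟩ := W.exists_norm_incl_le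
      have := h x
      rw [hx, mul_zero, norm_le_zero_iff] at this
      exact W.incl_injective (this.trans (map_zero W.incl).symm)
    · rintro rfl
      simp [norm_def, seminormAt_zero]

instance : NormedAddCommGroup W.Space := NormedAddCommGroup.ofCore W.core

instance : NormedSpace ℝ W.Space := NormedSpace.ofCore W.core

/-- The DFJP operator `J_W : X_W → X` associated to `W`: the identity map. -/
def dfjp : W.Space →L[ℝ] X :=
  LinearMap.mkContinuousOfExistsBound W.incl
    (W.exists_norm_incl_le.imp fun _ h => h.2)

theorem continuous_seminormAt (n : ℕ) : Continuous (W.seminormAt n) :=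
  continuous_gauge (W.convex_nbhd n) (W.nbhd_mem_nhds n)

/-- The space `X_W` is a Banach space. -/
instance [CompleteSpace X] : CompleteSpace W.Space := by
  refine Metric.complete_of_cauchySeq_tendsto fun u hu => ?_
  obtain ⟨x, hx⟩ := cauchySeq_tendsto_of_complete
    (W.dfjp.uniformContinuous.comp_cauchySeq hu)
  have hx : Filter.Tendsto (fun k => W.incl (u k)) Filter.atTop (𝓝 x) := hx
  have key : ∀ ε > 0, ∃ N, ∀ k ≥ N, ∀ s : Finset ℕ,
      ∑ n ∈ s, W.seminormAt (n + 1) (W.incl (u k) - x) ^ 2 ≤ ε ^ 2 := by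
    intro ε hε
    obtain ⟨N, hN⟩ := Metric.cauchySeq_iff.1 hu ε hε
    refine ⟨N, fun k hk s => ?_⟩
    have hlim : Filter.Tendsto
        (fun m => ∑ n ∈ s, W.seminormAt (n + 1) (W.incl (u k) - W.incl (u m)) ^ 2)
        Filter.atTop (𝓝 (∑ n ∈ s, W.seminormAt (n + 1) (W.incl (u k) - x) ^ 2)) :=
      tendsto_finsetSum _ fun n _ =>
        (((W.continuous_seminormAt (n + 1)).tendsto _).comp (hx.const_sub _)).pow 2
    refine le_of_tendsto hlim (Filter.eventually_atTop.2 ⟨N, fun m hm => ?_⟩)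
    have h1 : ‖u k - u m‖ ≤ ε := by
      rw [← dist_eq_norm]; exact (hN k hk m hm).le
    rw [← map_sub]
    refine ((W.summable_incl (u k - u m)).sum_le_tsum s fun _ _ => sq_nonneg _).trans ?_
    rw [norm_def] at h1
    exact (Real.sqrt_le_left hε.le).1 h1
  obtain ⟨N, hN⟩ := key 1 one_pos
  have hd : (W.incl (u N) - x) ∈ W.submodule :=
    summable_of_sum_le (fun n => sq_nonneg _) (hN N le_rfl)
  have hxW : x ∈ W.submodule := by
    have := W.submodule.sub_mem (u N).2 hd
    have e : W.incl (u N) - (W.incl (u N) - x) = x := by abel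
    exact e ▸ this
  let y : W.Space := (⟨x, hxW⟩ : W.submodule)
  refine ⟨y, Metric.tendsto_atTop.2 fun ε hε => ?_⟩
  obtain ⟨M, hM⟩ := key (ε / 2) (by positivity)
  refine ⟨M, fun k hk => ?_⟩
  have h2 : ‖u k - y‖ ≤ ε / 2 := by
    rw [norm_def, Real.sqrt_le_left (by positivity), map_sub]
    exact Real.tsum_le_of_sum_le (fun n => sq_nonneg _) (hM k hk)
  rw [dist_eq_norm]
  linarith

end BddAbsConvex

end DFJP

end

/-! Let `J₁`, `J₂` be the DFJP operators. Each `Wᵢ` lies in the `Jᵢ`-image of the unit ball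
(`exists_dfjp_eq_of_mem`), so `C₁ ⊗ C₂` lies in the image of the unit ball under `J₁ ⊗ J₂`. This
settles the direct implication.

For the converse, weak compactness is carried from `C₁ ⊗ C₂` to that image through three
enlargements. Bilinearity puts `W₁ ⊗ W₂` inside the absolutely convex hull of `C₁ ⊗ C₂` (up to
adjoining `0`), and Krein's theorem applies (`IsRelWeaklyCompact.convexHull`). Each `Jᵢ`-image of
the ball is uniformly approximated by multiples of `Wᵢ` (`exists_smul_near_dfjp`), hence so is their
tensor product by multiples of `W₁ ⊗ W₂`, and Grothendieck's lemma applies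
(`IsRelWeaklyCompact.of_approx`). Finally the image of the projective ball lies in the closed convex
hull of the tensor product of the two images (`map_image_closedBall_subset`), so Krein's theorem
applies again.

Both weak compactness theorems are proved in the bidual: weak* limit points of a bounded set must be
shown to lie in the space. For Krein, a limit point outside would give functionals null on finite
sets yet large on convex combinations, against dominated convergence. -/

/-! ### Weak compactness: Grothendieck's lemma and Krein's theorem -/

section WeakCompactness

open NormedSpace Filter MeasureTheory

/-- A bounded sequence of continuous functions on a compact space which tends to `0` pointwise
cannot be bounded away from `0` by a sequence of states in the sense that the `n`-th state is
large on the first `n` functions. -/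
theorem exists_state_lt_of_tendsto_zero {K : Type*} [TopologicalSpace K] [T2Space K]
    [CompactSpace K] (g : ℕ → C(K, ℝ)) {R : ℝ} (hR : ∀ m x, |g m x| ≤ R)
    (hg : ∀ x, Tendsto (fun m => g m x) atTop (𝓝 0))
    (L : ℕ → C(K, ℝ) →ₗ[ℝ] ℝ) (hpos : ∀ n h, 0 ≤ h → 0 ≤ L n h) (hone : ∀ n, L n 1 = 1)
    {ε : ℝ} (hε : 0 < ε) : ∃ m n, m ≤ n ∧ L n (g m) < ε := by
  by_contra! H
  let U : Ultrafilter ℕ := hyperfilter ℕ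
  have hbd (n : ℕ) (h : C(K, ℝ)) : L n h ∈ Set.Icc (-‖h‖) ‖h‖ := by
    have h1 := hpos n (‖h‖ • 1 - h) (fun x => by
      simpa using (le_abs_self _).trans (h.norm_coe_le_norm x))
    have h2 := hpos n (‖h‖ • 1 + h) (fun x => by
      have := (neg_le_abs _).trans (h.norm_coe_le_norm x)
      have h3 : (‖h‖ • (1 : C(K, ℝ)) + h) x = ‖h‖ + h x := by simp
      change 0 ≤ (‖h‖ • (1 : C(K, ℝ)) + h) x
      linarith)
    rw [map_sub, map_smul, hone, smul_eq_mul, mul_one] at h1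
    rw [map_add, map_smul, hone, smul_eq_mul, mul_one] at h2
    exact ⟨by linarith, by linarith⟩
  have hlim (h : C(K, ℝ)) : ∃ l, Tendsto (fun n => L n h) U (𝓝 l) := by
    obtain ⟨l, -, hl⟩ := (isCompact_Icc (a := -‖h‖) (b := ‖h‖)).ultrafilter_le_nhds
      (U.map fun n => L n h) (by
        rw [Ultrafilter.coe_map, le_principal_iff]
        exact Filter.mem_map.2 (univ_mem' fun n => hbd n h))
    exact ⟨l, hl⟩
  choose l hl using hlim
  -- The ultrafilter limit of the states is a positive functional, hence integration against a
  -- finite measure by Riesz–Markov–Kakutani.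
  let Λ : CompactlySupportedContinuousMap K ℝ →ₚ[ℝ] ℝ := PositiveLinearMap.mk₀
    { toFun := fun h => l h
      map_add' := fun a b => tendsto_nhds_unique (hl _)
        (((hl a).add (hl b)).congr fun n => (map_add (L n) _ _).symm)
      map_smul' := fun c a => tendsto_nhds_unique (hl _)
        (((hl a).const_mul c).congr fun n => (map_smul (L n) c _).symm) }
    (fun a ha => ge_of_tendsto (hl a) (Eventually.of_forall fun n => hpos n _ ha))
  let _ : MeasurableSpace K := borel K
  have : BorelSpace K := ⟨rfl⟩
  let μ := RealRMK.rieszMeasure Λ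
  have hint (h : C(K, ℝ)) : ∫ x, h x ∂μ = l h :=
    RealRMK.integral_rieszMeasure Λ (CompactlySupportedContinuousMap.continuousMapEquiv h)
  have hdct : Tendsto (fun m => ∫ x, g m x ∂μ) atTop (𝓝 (∫ _, (0 : ℝ) ∂μ)) :=
    tendsto_integral_of_dominated_convergence (fun _ => R)
      (fun m => (g m).continuous.aestronglyMeasurable) (integrable_const R)
      (fun m => Eventually.of_forall fun x => hR m x) (Eventually.of_forall hg)
  rw [integral_zero] at hdct
  -- For fixed `m` the bound `ε ≤ L n (g m)` holds for all `n ≥ m`, so it survives in the limit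
  -- along a nonprincipal ultrafilter.
  have hge (m : ℕ) : ε ≤ ∫ x, g m x ∂μ := by
    rw [hint]
    refine ge_of_tendsto (hl (g m)) ?_
    have : ∀ᶠ n in atTop, ε ≤ L n (g m) := (eventually_ge_atTop m).mono fun n hn => H m n hn
    exact (Nat.hyperfilter_le_atTop) this
  exact absurd (ge_of_tendsto' hdct hge) (not_le.2 hε)

variable {X : Type*} [NormedAddCommGroup X] [NormedSpace ℝ X]

theorem exists_extension_norm_le (p : Submodule ℝ X) (φ : StrongDual ℝ X) {ε : ℝ} (hε : 0 ≤ ε)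
    (h : ∀ f ∈ p, φ f ≤ ε * ‖f‖) :
    ∃ ψ : StrongDual ℝ X, (∀ f ∈ p, ψ f = φ f) ∧ ‖ψ‖ ≤ ε := by
  obtain ⟨ψ, hψ, hψn⟩ := _root_.exists_extension_norm_eq p (φ.comp p.subtypeL)
  refine ⟨ψ, fun f hf => hψ ⟨f, hf⟩, hψn.trans_le ?_⟩
  refine ContinuousLinearMap.opNorm_le_bound _ hε fun f => ?_
  rw [Real.norm_eq_abs, abs_le]
  have := h (-f) (p.neg_mem f.2)
  rw [map_neg, norm_neg] at this
  exact ⟨neg_le.1 this, h f f.2⟩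

/-- An isometric image of a complete space is closed. Halving the radius of a ball that misses it
makes the inequality strict. -/
theorem exists_lt_norm_sub_of_notMem_range_isometry {Z Y : Type*} [NormedAddCommGroup Z]
    [CompleteSpace Z] [NormedAddCommGroup Y] (J : Z → Y) (hJ : ∀ x x', ‖J x - J x'‖ = ‖x - x'‖)
    {y : Y} (h : y ∉ Set.range J) : ∃ ε > 0, ∀ x : Z, ε < ‖y - J x‖ := by
  have hJ' : Isometry J := Isometry.of_dist_eq fun x x' => by
    rw [dist_eq_norm, dist_eq_norm, hJ]
  obtain ⟨ε, hε, hb⟩ := Metric.mem_nhds_iff.1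
    (hJ'.isClosedEmbedding.isClosed_range.isOpen_compl.mem_nhds h)
  refine ⟨ε / 2, by positivity, fun x => ?_⟩
  by_contra! hx
  refine hb (show J x ∈ Metric.ball y ε from ?_) ⟨x, rfl⟩
  rw [Metric.mem_ball, dist_comm, dist_eq_norm]
  linarith

/-- A functional on the dual whose distance to all `x ∈ X` exceeds `ε` exceeds `ε` at a
functional of norm at most one that vanishes on a given finite set. -/
theorem exists_dual_vanishing_of_lt_norm_sub (φ : StrongDual ℝ (StrongDual ℝ X)) {ε : ℝ}
    (h : ∀ x : X, ε < ‖φ - inclusionInDoubleDual ℝ X x‖) (E : Finset X) :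
    ∃ f : StrongDual ℝ X, ‖f‖ ≤ 1 ∧ (∀ e ∈ E, f e = 0) ∧ ε < φ f := by
  by_contra! H
  have hε : 0 ≤ ε := by simpa using H 0 (by simp) (by simp)
  let p : Submodule ℝ (StrongDual ℝ X) :=
    ⨅ e : E, LinearMap.ker (inclusionInDoubleDual ℝ X e.1).toLinearMap
  have hp (f : StrongDual ℝ X) : f ∈ p ↔ ∀ e ∈ E, f e = 0 := by
    simp [p, Submodule.mem_iInf]
  have key (f : StrongDual ℝ X) (hfp : f ∈ p) : φ f ≤ ε * ‖f‖ := by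
    rcases eq_or_ne f 0 with rfl | hf
    · simp
    have hf' : 0 < ‖f‖ := norm_pos_iff.2 hf
    have := H (‖f‖⁻¹ • f)
      (by rw [norm_smul, norm_inv, norm_norm]; exact (inv_mul_cancel₀ hf'.ne').le)
      (fun e he => by simp [(hp f).1 hfp e he])
    rw [map_smul, smul_eq_mul, inv_mul_le_iff₀ hf'] at this
    linarith
  -- On the annihilator `p` of `E` the functional `φ` is bounded by `ε`, so it extends from `p` with
  -- norm at most `ε`. The difference `φ - ψ` vanishes on `p` and is therefore evaluation at a point
  -- of the span of `E`, which lies too close to `φ`.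
  obtain ⟨ψ, hψ, hψn⟩ := exists_extension_norm_le p φ hε key
  have hspan := mem_span_of_iInf_ker_le_ker
    (L := fun e : E => (inclusionInDoubleDual ℝ X e.1).toLinearMap)
    (K := (φ - ψ).toLinearMap) (fun f hf => by
      simp [hψ f hf])
  obtain ⟨c, hc⟩ := (Submodule.mem_span_range_iff_exists_fun ℝ).1 hspan
  refine absurd (h (∑ e : E, c e • e.1)) (not_lt.2 ?_)
  have : φ - inclusionInDoubleDual ℝ X (∑ e : E, c e • e.1) = ψ := by
    ext f
    have := LinearMap.congr_fun hc f
    simp only [LinearMap.coe_sum, Finset.sum_apply, LinearMap.smul_apply] at this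
    simp only [map_sum, map_smul, sub_apply, sum_apply,
      smul_apply]
    have h2 : (∑ e : E, c e • (inclusionInDoubleDual ℝ X e.1) f) = φ f - ψ f := this
    rw [h2]; ring
  rw [this]
  exact hψn

theorem exists_mem_forall_lt_of_mem_weakStar_closure {A : Set X} {φ : WeakDual ℝ (StrongDual ℝ X)}
    (h : φ ∈ closure (inclusionInDoubleDualWeak ℝ X '' (toWeakSpace ℝ X '' A)))
    (F : Finset (StrongDual ℝ X)) {c : ℝ} (hF : ∀ f ∈ F, c < φ f) :
    ∃ a ∈ A, ∀ f ∈ F, c < f a := by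
  have hopen : IsOpen (⋂ f ∈ F, {ψ : WeakDual ℝ (StrongDual ℝ X) | c < ψ f}) :=
    isOpen_biInter_finset fun f _ =>
      isOpen_lt continuous_const (WeakDual.eval_continuous f)
  obtain ⟨_, h1, _, ⟨a, ha, rfl⟩, rfl⟩ := mem_closure_iff.1 h _ hopen (by simpa using hF)
  refine ⟨a, ha, fun f hf => ?_⟩
  have := Set.mem_iInter₂.1 h1 f hf
  exact this

theorem exists_lt_norm_sub_of_notMem_range [CompleteSpace X]
    {φ : StrongDual ℝ (StrongDual ℝ X)} (h : φ ∉ Set.range (inclusionInDoubleDual ℝ X)) :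
    ∃ ε > 0, ∀ x : X, ε < ‖φ - inclusionInDoubleDual ℝ X x‖ := by
  refine exists_lt_norm_sub_of_notMem_range_isometry _ (fun x x' => ?_) h
  exact (congrArg norm ((inclusionInDoubleDual ℝ X).map_sub x x').symm).trans
    ((inclusionInDoubleDualLi (E := X) ℝ).norm_map (x - x'))

/-- The weak* closure in the bidual is compact by Banach–Alaoglu, so it only has to stay inside `X`.
As `X` is norm closed in its bidual, approximability of the limit points by elements of `X` is
enough. -/
theorem IsRelWeaklyCompact.of_bounded [CompleteSpace X] {A : Set X}
    (hA : Bornology.IsBounded A)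
    (h : ∀ φ : WeakDual ℝ (StrongDual ℝ X),
      φ ∈ closure (inclusionInDoubleDualWeak ℝ X '' (toWeakSpace ℝ X '' A)) →
      ∀ ε > 0, ∃ x : X,
        ‖WeakDual.toStrongDual φ - inclusionInDoubleDual ℝ X x‖ ≤ ε) :
    IsRelWeaklyCompact A := by
  refine isCompact_closure_of_isBounded _ _ _ ?_ fun φ hφ => ?_
  · rwa [Set.preimage_image_eq _ (toWeakSpace ℝ X).injective]
  · by_contra hn
    obtain ⟨ε, hε, hx⟩ := exists_lt_norm_sub_of_notMem_range (φ := WeakDual.toStrongDual φ)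
      (fun ⟨x, hx⟩ => hn ⟨toWeakSpace ℝ X x, hx⟩)
    obtain ⟨x, hx'⟩ := h φ hφ ε hε
    exact absurd (hx x) (not_lt.2 hx')

theorem IsRelWeaklyCompact.mono {A B : Set X} (hB : IsRelWeaklyCompact B) (h : A ⊆ B) :
    IsRelWeaklyCompact A :=
  IsCompact.of_isClosed_subset hB isClosed_closure (closure_mono (Set.image_mono h))

theorem IsRelWeaklyCompact.norm_closure {A : Set X} (hA : IsRelWeaklyCompact A) :
    IsRelWeaklyCompact (closure A) := by
  refine IsCompact.of_isClosed_subset hA isClosed_closure (closure_minimal ?_ isClosed_closure)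
  rintro _ ⟨x, hx, rfl⟩
  exact image_closure_subset_closure_image (toWeakSpaceCLM ℝ X).continuous ⟨x, hx, rfl⟩

theorem IsRelWeaklyCompact.union {A B : Set X} (hA : IsRelWeaklyCompact A)
    (hB : IsRelWeaklyCompact B) : IsRelWeaklyCompact (A ∪ B) := by
  unfold IsRelWeaklyCompact at *
  rw [Set.image_union, closure_union]
  exact IsCompact.union hA hB

theorem IsRelWeaklyCompact.singleton (x : X) : IsRelWeaklyCompact ({x} : Set X) := by
  unfold IsRelWeaklyCompact
  rw [Set.image_singleton]
  exact isCompact_singleton.closure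

theorem IsRelWeaklyCompact.const_smul {A : Set X} (hA : IsRelWeaklyCompact A) (c : ℝ) :
    IsRelWeaklyCompact (c • A) := by
  have hc : Continuous fun x : WeakSpace ℝ X => c • x := continuous_const.smul continuous_id
  refine IsCompact.closure_of_subset (hA.image hc) ?_
  rintro _ ⟨_, ⟨x, hx, rfl⟩, rfl⟩
  exact ⟨toWeakSpace ℝ X x, subset_closure ⟨x, hx, rfl⟩, rfl⟩

/-- **Grothendieck's lemma**: a set that can be approximated uniformly by relatively weakly
compact sets is relatively weakly compact. -/
theorem IsRelWeaklyCompact.of_approx [CompleteSpace X] {A : Set X}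
    (hA : Bornology.IsBounded A)
    (h : ∀ ε > 0, ∃ K : Set X, IsRelWeaklyCompact K ∧ ∀ a ∈ A, ∃ k ∈ K, ‖a - k‖ ≤ ε) :
    IsRelWeaklyCompact A := by
  refine .of_bounded hA fun φ hφ ε hε => ?_
  obtain ⟨K, hK, hAK⟩ := h ε hε
  have h1 : IsCompact (inclusionInDoubleDualWeak ℝ X '' closure (toWeakSpace ℝ X '' K)) :=
    IsCompact.image hK (inclusionInDoubleDualWeak ℝ X).continuous
  -- In the bidual, the weak closure of `K` plus the `ε`-ball is a sum of two weak* compact sets,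
  -- hence weak* closed. It contains `A`, and so every limit point of `A`.
  have h2 := WeakDual.isCompact_closedBall (𝕜 := ℝ) (0 : StrongDual ℝ (StrongDual ℝ X)) ε
  have h3 := closure_minimal (s := inclusionInDoubleDualWeak ℝ X '' (toWeakSpace ℝ X '' A))
    ?_ (h1.add h2).isClosed
  · obtain ⟨_, ⟨x, -, rfl⟩, ψ, hψ, rfl⟩ := h3 hφ
    refine ⟨(toWeakSpace ℝ X).symm x, ?_⟩
    rw [Set.mem_preimage, mem_closedBall_zero_iff] at hψ
    refine le_of_eq_of_le (congrArg norm ?_) hψ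
    ext f
    exact add_sub_cancel_left (f ((toWeakSpace ℝ X).symm x)) (ψ f)
  · rintro _ ⟨_, ⟨a, ha, rfl⟩, rfl⟩
    obtain ⟨k, hk, hak⟩ := hAK a ha
    refine ⟨inclusionInDoubleDualWeak ℝ X (toWeakSpace ℝ X k),
      ⟨_, subset_closure ⟨k, hk, rfl⟩, rfl⟩,
      inclusionInDoubleDualWeak ℝ X (toWeakSpace ℝ X (a - k)), ?_, ?_⟩
    · rw [Set.mem_preimage, mem_closedBall_zero_iff]
      exact (double_dual_bound ℝ X (a - k)).trans hak
    · change inclusionInDoubleDualWeak ℝ X (toWeakSpace ℝ X k) + _ = _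
      rw [← map_add, ← map_add, add_sub_cancel]

/-- **Krein's theorem**: the convex hull of a relatively weakly compact set is relatively weakly
compact. -/
theorem IsRelWeaklyCompact.convexHull [CompleteSpace X] {A : Set X}
    (hA : Bornology.IsBounded A) (h : IsRelWeaklyCompact A) :
    IsRelWeaklyCompact (convexHull ℝ A) := by
  refine isCompact_closure_of_isBounded _ _ _ ?_ fun φ hφ => ?_
  · rw [Set.preimage_image_eq _ (toWeakSpace ℝ X).injective]
    exact isBounded_convexHull.2 hA
  by_contra hn
  obtain ⟨ε, hε, hx⟩ := exists_lt_norm_sub_of_notMem_range (φ := WeakDual.toStrongDual φ)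
    (fun ⟨x, hx⟩ => hn ⟨toWeakSpace ℝ X x, hx⟩)
  -- Recursive choice of triples `(fₙ, Eₙ, aₙ)`, with `Eₙ ⊆ A` finite and `aₙ` in its convex hull:
  -- `fₘ` vanishes on `Eₙ` for `n < m`, while `fₘ aₙ > ε` for `m ≤ n`.
  obtain ⟨s, hs, hsr⟩ := exists_seq_of_forall_finset_exists
    (fun t : StrongDual ℝ X × Finset X × X => (‖t.1‖ ≤ 1 ∧ ε < φ t.1) ∧
      (t.2.1 : Set X) ⊆ A ∧ t.2.2 ∈ _root_.convexHull ℝ (t.2.1 : Set X) ∧ ε < t.1 t.2.2)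
    (fun t u => (∀ e ∈ t.2.1, u.1 e = 0) ∧ ε < t.1 u.2.2) (fun S hS => by
      classical
      obtain ⟨f, hf1, hf0, hfφ⟩ := exists_dual_vanishing_of_lt_norm_sub _ hx
        (S.biUnion fun t => t.2.1)
      obtain ⟨a, ha, hfa⟩ := exists_mem_forall_lt_of_mem_weakStar_closure hφ (insert f (S.image Prod.fst))
        (c := ε) (by
          simp only [Finset.mem_insert, Finset.mem_image]
          rintro g (rfl | ⟨t, ht, rfl⟩)
          · exact hfφ
          · exact (hS t ht).1.2)
      rw [convexHull_eq_union_convexHull_finite_subsets] at ha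
      simp only [Set.mem_iUnion] at ha
      obtain ⟨E, hE, haE⟩ := ha
      refine ⟨(f, E, a), ⟨⟨hf1, hfφ⟩, hE, haE, hfa f (Finset.mem_insert_self _ _)⟩,
        fun t ht => ⟨fun e he => hf0 e (Finset.mem_biUnion.2 ⟨t, ht, he⟩),
          hfa t.1 (Finset.mem_insert_of_mem (Finset.mem_image_of_mem _ ht))⟩⟩)
  obtain ⟨R, hR⟩ := hA.exists_norm_le
  -- The `fₘ` need not tend to `0` on the whole weak closure of `A`. They do on `X₀`, which is norm
  -- closed because `‖fₘ‖ ≤ 1`, hence weakly closed by convexity. It contains every `Eₙ`, since `fₘ`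
  -- vanishes there for `m > n`.
  let X₀ : Submodule ℝ X :=
    { carrier := {x | Tendsto (fun m => (s m).1 x) atTop (𝓝 0)}
      zero_mem' := by simp
      add_mem' := fun {x y} hx hy => by simpa using Tendsto.add hx hy
      smul_mem' := fun c x hx => by simpa using Tendsto.const_mul c hx }
  have hX₀ : IsClosed (X₀ : Set X) := by
    refine isClosed_of_closure_subset fun x hx => ?_
    refine Metric.tendsto_atTop.2 fun δ hδ => ?_
    obtain ⟨y, hy, hxy⟩ := Metric.mem_closure_iff.1 hx (δ / 2) (by positivity)
    obtain ⟨N, hN⟩ := Metric.tendsto_atTop.1 hy (δ / 2) (by positivity)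
    refine ⟨N, fun m hm => ?_⟩
    have h1 := hN m hm
    have h2 : ‖(s m).1 (x - y)‖ ≤ ‖x - y‖ := by
      simpa using (s m).1.le_of_opNorm_le (hs m).1.1 (x - y)
    rw [dist_zero_right] at h1 ⊢
    rw [dist_eq_norm] at hxy
    have h3 : (s m).1 x = (s m).1 (x - y) + (s m).1 y := by simp
    rw [h3]
    exact (norm_add_le _ _).trans_lt (by linarith)
  have hX₀w : IsClosed (toWeakSpace ℝ X '' (X₀ : Set X)) := by
    have := X₀.convex.toWeakSpace_closure ℝ
    rw [hX₀.closure_eq] at this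
    rw [this]
    exact isClosed_closure
  let K : Set (WeakSpace ℝ X) := closure (toWeakSpace ℝ X '' A) ∩ toWeakSpace ℝ X '' (X₀ : Set X)
  have : CompactSpace K := isCompact_iff_compactSpace.1 (IsCompact.inter_right h hX₀w)
  have hev (f : StrongDual ℝ X) : Continuous fun x : WeakSpace ℝ X => f ((toWeakSpace ℝ X).symm x) :=
    WeakBilin.eval_continuous (topDualPairing ℝ X).flip f
  let g (m : ℕ) : C(K, ℝ) :=
    ⟨fun x => (s m).1 ((toWeakSpace ℝ X).symm x.1), (hev (s m).1).comp continuous_subtype_val⟩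
  have hE (n : ℕ) (e : X) (he : e ∈ (s n).2.1) : toWeakSpace ℝ X e ∈ K := by
    refine ⟨subset_closure ⟨e, (hs n).2.1 he, rfl⟩, e, ?_, rfl⟩
    refine tendsto_const_nhds.congr' ((eventually_gt_atTop n).mono fun m hm => ?_)
    exact ((hsr n m hm).1 e he).symm
  -- The convex weights expressing `aₙ` through `Eₙ ⊆ K` define a state on `C(K, ℝ)`.
  have hL (n : ℕ) : ∃ L : C(K, ℝ) →ₗ[ℝ] ℝ, (∀ h, 0 ≤ h → 0 ≤ L h) ∧ L 1 = 1 ∧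
      ∀ m, L (g m) = (s m).1 (s n).2.2 := by
    obtain ⟨w, hw0, hw1, hw⟩ := Finset.mem_convexHull'.1 (hs n).2.2.1
    refine ⟨∑ e : (s n).2.1, w e.1 •
      (ContinuousMap.evalCLM ℝ (⟨_, hE n e.1 e.2⟩ : K)).toLinearMap, ?_, ?_, ?_⟩
    · intro h hh
      simp only [LinearMap.coe_sum, Finset.sum_apply, LinearMap.smul_apply]
      exact Finset.sum_nonneg fun e _ => mul_nonneg (hw0 _ e.2) (hh _)
    · simp only [LinearMap.coe_sum, Finset.sum_apply, LinearMap.smul_apply]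
      refine Eq.trans ?_ ((Finset.sum_coe_sort _ w).trans hw1)
      exact Finset.sum_congr rfl fun (e : (s n).2.1) _ => mul_one (w e.1)
    · intro m
      simp only [LinearMap.coe_sum, Finset.sum_apply, LinearMap.smul_apply]
      rw [← hw, map_sum]
      refine Eq.trans ?_ (Finset.sum_coe_sort _ fun e => (s m).1 (w e • e))
      exact Finset.sum_congr rfl fun (e : (s n).2.1) _ => ((s m).1.map_smul (w e.1) e.1).symm
  choose L hL0 hL1 hLg using hL
  obtain ⟨m, n, hmn, hlt⟩ := exists_state_lt_of_tendsto_zero g (R := R) (fun m x => by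
      have hc : IsClosed {x : WeakSpace ℝ X | |(s m).1 ((toWeakSpace ℝ X).symm x)| ≤ R} :=
        isClosed_le (hev _).abs continuous_const
      refine closure_minimal ?_ hc x.2.1
      rintro _ ⟨a, ha, rfl⟩
      have := (s m).1.le_of_opNorm_le (hs m).1.1 a
      rw [one_mul] at this
      exact this.trans (hR a ha))
    (fun x => by
      obtain ⟨y, hy, hyx⟩ := x.2.2
      have : (toWeakSpace ℝ X).symm x.1 = y := by rw [← hyx, LinearEquiv.symm_apply_apply]
      simp only [g, ContinuousMap.coe_mk, this]
      exact hy) L hL0 hL1 hε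
  rw [hLg] at hlt
  rcases hmn.eq_or_lt with rfl | hmn
  · exact absurd (hs m).2.2.2 (not_lt.2 hlt.le)
  · exact absurd (hsr m n hmn).2 (not_lt.2 hlt.le)

theorem IsRelWeaklyCompact.absConvexHull [CompleteSpace X] {A : Set X}
    (hA : Bornology.IsBounded A) (h : IsRelWeaklyCompact A) :
    IsRelWeaklyCompact (absConvexHull ℝ A) := by
  rw [← convexHull_union_neg_eq_absConvexHull]
  refine IsRelWeaklyCompact.convexHull (hA.union hA.neg) (h.union ?_)
  simpa using h.const_smul (-1)

end WeakCompactness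

/-! ### Unit ball and absolutely convex hulls in the projective tensor product -/

section ProjectiveTensorProduct

variable {X Y X₁ X₂ Y₁ Y₂ : Type*}
  [NormedAddCommGroup X] [NormedSpace ℝ X] [NormedAddCommGroup Y] [NormedSpace ℝ Y]
  [NormedAddCommGroup X₁] [NormedSpace ℝ X₁] [NormedAddCommGroup X₂] [NormedSpace ℝ X₂]
  [NormedAddCommGroup Y₁] [NormedSpace ℝ Y₁] [NormedAddCommGroup Y₂] [NormedSpace ℝ Y₂]

namespace ProjTensor

theorem norm_tmul_le (x : X) (y : Y) : ‖tmul x y‖ ≤ ‖x‖ * ‖y‖ := by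
  have : Nonempty {S : X →L[ℝ] Y →L[ℝ] ℝ // ‖S‖ ≤ 1} :=
    ⟨⟨0, ContinuousLinearMap.opNorm_zero.trans_le zero_le_one⟩⟩
  refine (UniformSpace.Completion.norm_coe (E := AlgTensor X Y) _).trans_le ?_
  refine ciSup_le fun S => ?_
  calc |S.1 x y| ≤ ‖S.1‖ * ‖x‖ * ‖y‖ := S.1.le_opNorm₂ x y
    _ ≤ 1 * ‖x‖ * ‖y‖ := by gcongr; exact S.2
    _ = ‖x‖ * ‖y‖ := by rw [one_mul]

/-- The canonical bilinear map of norm at most one into the projective tensor product. -/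
noncomputable def tmulL (X Y : Type*) [NormedAddCommGroup X] [NormedSpace ℝ X]
    [NormedAddCommGroup Y] [NormedSpace ℝ Y] : X →L[ℝ] Y →L[ℝ] ProjTensor X Y :=
  LinearMap.mkContinuous₂
    ((TensorProduct.mk ℝ X Y).compr₂
      (UniformSpace.Completion.toComplL :
        AlgTensor X Y →L[ℝ] ProjTensor X Y).toLinearMap : X →ₗ[ℝ] Y →ₗ[ℝ] ProjTensor X Y) 1
    fun x y => by rw [one_mul]; exact norm_tmul_le x y

theorem tmulL_apply (x : X) (y : Y) : tmulL X Y x y = tmul x y := rfl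

/-- A bound for a continuous functional on elementary tensors extends to the whole projective
tensor product. -/
theorem le_of_bilinear_bound (f : ProjTensor X Y →L[ℝ] ℝ) {u : ℝ} (hu : 0 ≤ u)
    (h : ∀ x y, f (tmul x y) ≤ u * ‖x‖ * ‖y‖) (z : ProjTensor X Y) : f z ≤ u * ‖z‖ := by
  -- Restricted to elementary tensors, `f` is a bilinear form of norm at most `u`; the one-sided
  -- bound suffices because `x` may be replaced by `-x`. The definition of the projective norm then
  -- bounds `f`.
  let S : X →L[ℝ] Y →L[ℝ] ℝ := (ContinuousLinearMap.compL ℝ Y (ProjTensor X Y) ℝ f).comp (tmulL X Y)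
  have hS : ‖S‖ ≤ u := by
    refine ContinuousLinearMap.opNorm_le_bound₂ _ hu fun x y => ?_
    rw [Real.norm_eq_abs, abs_le]
    have h1 := h (-x) y
    have h2 : S (-x) y = - S x y := by rw [map_neg]; rfl
    rw [norm_neg] at h1
    change S (-x) y ≤ _ at h1
    exact ⟨by linarith, h x y⟩
  refine UniformSpace.Completion.induction_on z
    (isClosed_le f.continuous (continuous_const.mul continuous_norm)) fun w => ?_
  have hw : f.toLinearMap.comp (UniformSpace.Completion.toComplL :
      AlgTensor X Y →L[ℝ] ProjTensor X Y).toLinearMap = AlgTensor.functional S :=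
    TensorProduct.ext' fun x y => rfl
  have hw' : f (w : ProjTensor X Y) = AlgTensor.functional S w := LinearMap.congr_fun hw w
  rw [hw', UniformSpace.Completion.norm_coe]
  exact (le_abs_self _).trans ((AlgTensor.functional_le S w).trans (by gcongr))

/-- A functional separating a point from the right-hand side would, composed with `map T₁ T₂`, be a
bilinear form bounded by `u` on pairs of unit vectors, hence by `u` on the projective unit ball. -/
theorem map_image_closedBall_subset (T₁ : Y₁ →L[ℝ] X₁) (T₂ : Y₂ →L[ℝ] X₂) :
    map T₁ T₂ '' Metric.closedBall 0 1 ⊆ closure (convexHull ℝ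
      (setTmul (T₁ '' Metric.closedBall 0 1) (T₂ '' Metric.closedBall 0 1))) := by
  rintro _ ⟨z, hz, rfl⟩
  by_contra hn
  obtain ⟨f, u, hu, hfz⟩ := geometric_hahn_banach_closed_point
    (convex_convexHull ℝ _).closure isClosed_closure hn
  have hQ (y₁ : Y₁) (h₁ : ‖y₁‖ ≤ 1) (y₂ : Y₂) (h₂ : ‖y₂‖ ≤ 1) : f (tmul (T₁ y₁) (T₂ y₂)) ≤ u :=
    (hu _ (subset_closure (subset_convexHull ℝ _
      ⟨_, ⟨y₁, by simpa using h₁, rfl⟩, _, ⟨y₂, by simpa using h₂, rfl⟩, rfl⟩))).le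
  have hu0 : 0 ≤ u := by
    simpa [← tmulL_apply] using hQ 0 (by simp) 0 (by simp)
  have key := le_of_bilinear_bound (f.comp (map T₁ T₂)) hu0 (fun y₁ y₂ => ?_) z
  · rw [mem_closedBall_zero_iff] at hz
    exact absurd hfz (not_lt.2 (key.trans (mul_le_of_le_one_right hu0 hz)))
  · rcases eq_or_ne y₁ 0 with rfl | h₁
    · simp [← tmulL_apply]
    rcases eq_or_ne y₂ 0 with rfl | h₂
    · simp [← tmulL_apply]
    have h₁' := norm_pos_iff.2 h₁
    have h₂' := norm_pos_iff.2 h₂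
    have := hQ (‖y₁‖⁻¹ • y₁) (by rw [norm_smul, norm_inv, norm_norm, inv_mul_cancel₀ h₁'.ne'])
      (‖y₂‖⁻¹ • y₂) (by rw [norm_smul, norm_inv, norm_norm, inv_mul_cancel₀ h₂'.ne'])
    simp only [← tmulL_apply, map_smul, smul_apply, smul_eq_mul] at this
    rw [inv_mul_le_iff₀ h₂', inv_mul_le_iff₀ h₁'] at this
    rw [ContinuousLinearMap.comp_apply, map_tmul, ← tmulL_apply]
    linarith

theorem isBounded_setTmul {C₁ : Set X} {C₂ : Set Y} (h₁ : Bornology.IsBounded C₁)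
    (h₂ : Bornology.IsBounded C₂) : Bornology.IsBounded (setTmul C₁ C₂) := by
  obtain ⟨r, hr⟩ := h₁.exists_norm_le
  obtain ⟨s, hs⟩ := h₂.exists_norm_le
  refine isBounded_iff_forall_norm_le.2 ⟨r * s, ?_⟩
  rintro _ ⟨x, hx, y, hy, rfl⟩
  exact (norm_tmul_le x y).trans (mul_le_mul (hr x hx) (hs y hy) (norm_nonneg y)
    ((norm_nonneg x).trans (hr x hx)))

theorem absConvex_preimage {E F : Type*} [AddCommGroup E] [Module ℝ E] [AddCommGroup F]
    [Module ℝ F] (f : E →ₗ[ℝ] F) {s : Set F} (hs : AbsConvex ℝ s) : AbsConvex ℝ (f ⁻¹' s) := by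
  refine ⟨fun a ha => ?_, hs.2.linear_preimage f⟩
  rintro _ ⟨x, hx, rfl⟩
  exact hs.1 a ha ⟨f x, hx, (map_smul f a x).symm⟩

/-- One variable is treated at a time: preimages of absolutely convex sets under the linear maps `a
↦ a ⊗ b` and `b ↦ x ⊗ b` are absolutely convex. -/
theorem tmul_mem_absConvexHull {C₁ : Set X} {C₂ : Set Y} {x : X} (hx : x ∈ absConvexHull ℝ C₁)
    {y : Y} (hy : y ∈ absConvexHull ℝ C₂) : tmul x y ∈ absConvexHull ℝ (setTmul C₁ C₂) := by
  have h1 : ∀ b ∈ C₂, ∀ a ∈ absConvexHull ℝ C₁, tmul a b ∈ absConvexHull ℝ (setTmul C₁ C₂) := by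
    intro b hb
    exact absConvexHull_min
      (fun a ha => subset_absConvexHull (Set.mem_image2_of_mem ha hb))
      (absConvex_preimage ((tmulL X Y).flip b).toLinearMap absConvex_absConvexHull)
  exact absConvexHull_min (fun b hb => h1 b hb x hx)
    (absConvex_preimage (tmulL X Y x).toLinearMap absConvex_absConvexHull) hy

end ProjTensor

end ProjectiveTensorProduct

/-! ### Comparison of `W` with the image of the unit ball under its DFJP operator -/

section DFJPOperators

namespace BddAbsConvex

variable {X : Type*} [NormedAddCommGroup X] [NormedSpace ℝ X] (W : BddAbsConvex X)

theorem dfjp_apply (y : W.Space) : W.dfjp y = W.incl y := rfl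

theorem exists_dfjp_eq_of_mem {x : X} (hx : x ∈ W.carrier) :
    ∃ y : W.Space, ‖y‖ ≤ 1 ∧ W.dfjp y = x := by
  have hle (n : ℕ) : W.seminormAt (n + 1) x ≤ ((2 : ℝ) ^ (n + 1))⁻¹ := by
    refine gauge_le_of_mem (by positivity) ?_
    rw [Set.mem_inv_smul_set_iff₀ (by positivity)]
    exact ⟨_, Set.smul_mem_smul_set hx, 0, ⟨0, by simp, smul_zero _⟩, add_zero _⟩
  -- The actual bound is `4⁻⁽ⁿ⁺¹⁾`; the weaker geometric majorant is chosen because its sum is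
  -- exactly `1`.
  have hle2 (n : ℕ) : W.seminormAt (n + 1) x ^ 2 ≤ (1 / 2) / 2 ^ n := by
    refine (pow_le_pow_left₀ (W.seminormAt_nonneg _ _) (hle n) 2).trans ?_
    have h1 : (1 : ℝ) ≤ 2 ^ n := one_le_pow₀ one_le_two
    rw [← inv_pow, ← pow_mul, inv_pow, div_div, ← pow_succ', one_div]
    exact inv_anti₀ (by positivity) (pow_le_pow_right₀ one_le_two (by lia))
  have hs : Summable fun n : ℕ => W.seminormAt (n + 1) x ^ 2 :=
    Summable.of_nonneg_of_le (fun n => sq_nonneg _) hle2 (summable_geometric_two' _)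
  refine ⟨(⟨x, hs⟩ : W.submodule), ?_, rfl⟩
  refine Real.sqrt_le_iff.2 ⟨zero_le_one, ?_⟩
  rw [one_pow]
  refine (hs.tsum_le_tsum hle2 (summable_geometric_two' _)).trans ?_
  rw [tsum_geometric_two']

/-- Each term of the defining series is at most `‖y‖ ^ 2`, so the gauge of `W.nbhd (n + 1)` at the
image of `y` is at most `1`. The factor `2` gives room, as a gauge equal to `1` does not ensure
membership. -/
theorem exists_smul_near_dfjp {y : W.Space} (hy : ‖y‖ ≤ 1) (n : ℕ) :
    ∃ w ∈ W.carrier,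
      ‖W.dfjp y - (2 * 2 ^ (n + 1) : ℝ) • w‖ ≤ 2 * ((2 : ℝ) ^ (n + 1))⁻¹ := by
  have h := (W.seminormAt_le_norm y n).trans hy
  have hmem : W.incl y ∈ (2 : ℝ) • W.nbhd (n + 1) := by
    obtain ⟨b, hb, hb2, hx⟩ := exists_lt_of_gauge_lt (W.absorbent_nbhd (n + 1))
      (h.trans_lt one_lt_two)
    refine (W.balanced_nbhd (n + 1)).smul_mono ?_ hx
    rw [Real.norm_of_nonneg hb.le, Real.norm_of_nonneg two_pos.le]
    exact hb2.le
  obtain ⟨_, ⟨_, ⟨w, hw, rfl⟩, _, ⟨e, he, rfl⟩, rfl⟩, hx⟩ := hmem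
  refine ⟨w, hw, ?_⟩
  rw [mem_closedBall_zero_iff] at he
  have : W.dfjp y - (2 * 2 ^ (n + 1) : ℝ) • w = (2 * ((2 : ℝ) ^ (n + 1))⁻¹) • e := by
    rw [dfjp_apply, ← hx]
    simp only [smul_add, smul_smul, add_sub_cancel_left]
  rw [this, norm_smul, Real.norm_of_nonneg (by positivity)]
  exact mul_le_of_le_one_right (by positivity) he

end BddAbsConvex

end DFJPOperators

/-! ### Transfer of weak compactness from `C₁ ⊗ C₂` to the image of the ball -/

theorem ProjTensor.norm_tmul_sub_tmul_le {X Y : Type*} [NormedAddCommGroup X] [NormedSpace ℝ X]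
    [NormedAddCommGroup Y] [NormedSpace ℝ Y] (x v : X) (y w : Y) :
    ‖tmul x y - tmul v w‖ ≤ ‖x - v‖ * ‖y‖ + ‖v‖ * ‖y - w‖ := by
  have : tmul x y - tmul v w = tmul (x - v) y + tmul v (y - w) := by
    simp only [← tmulL_apply, map_sub, sub_apply]
    abel
  rw [this]
  exact (norm_add_le _ _).trans (add_le_add (norm_tmul_le _ _) (norm_tmul_le _ _))

/-- Approximating both factors by multiples of elements of `W₁` and `W₂` approximates their tensor
by an element of a fixed multiple of `W₁ ⊗ W₂`, uniformly on the unit balls; Grothendieck's lemma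
concludes. -/
theorem isRelWeaklyCompact_setTmul_dfjp
    {X₁ : Type*} [NormedAddCommGroup X₁] [NormedSpace ℝ X₁]
    {X₂ : Type*} [NormedAddCommGroup X₂] [NormedSpace ℝ X₂]
    (W₁ : BddAbsConvex X₁) (W₂ : BddAbsConvex X₂)
    (h : IsRelWeaklyCompact (ProjTensor.setTmul W₁.carrier W₂.carrier)) :
    IsRelWeaklyCompact (ProjTensor.setTmul (W₁.dfjp '' Metric.closedBall 0 1)
      (W₂.dfjp '' Metric.closedBall 0 1)) := by
  refine .of_approx (ProjTensor.isBounded_setTmul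
    (W₁.dfjp.lipschitz.isBounded_image Metric.isBounded_closedBall)
    (W₂.dfjp.lipschitz.isBounded_image Metric.isBounded_closedBall)) fun ε hε => ?_
  -- With errors `2 * d` in each factor, the total error is at most `d * M`. The summand `‖W₁.dfjp‖
  -- + 1` bounds `‖c • w₁‖`, because `2 * d ≤ 1`.
  let M : ℝ := 2 * (‖W₂.dfjp‖ + (‖W₁.dfjp‖ + 1))
  have hlim : Filter.Tendsto (fun n : ℕ => ((2 : ℝ) ^ (n + 1))⁻¹ * M) Filter.atTop (𝓝 (0 * M)) :=
    (tendsto_inv_atTop_zero.comp ((Filter.tendsto_add_atTop_iff_nat 1).2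
      (tendsto_pow_atTop_atTop_of_one_lt one_lt_two))).mul_const M
  rw [zero_mul] at hlim
  obtain ⟨n, hn⟩ := ((hlim.eventually (gt_mem_nhds hε))).exists
  set c : ℝ := 2 * 2 ^ (n + 1) with hc
  set d : ℝ := ((2 : ℝ) ^ (n + 1))⁻¹ with hd
  refine ⟨(c * c) • ProjTensor.setTmul W₁.carrier W₂.carrier, h.const_smul _, ?_⟩
  rintro _ ⟨_, ⟨y₁, h₁, rfl⟩, _, ⟨y₂, h₂, rfl⟩, rfl⟩
  rw [mem_closedBall_zero_iff] at h₁ h₂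
  obtain ⟨w₁, hw₁, hn₁⟩ := W₁.exists_smul_near_dfjp h₁ n
  obtain ⟨w₂, hw₂, hn₂⟩ := W₂.exists_smul_near_dfjp h₂ n
  rw [← hc, ← hd] at hn₁ hn₂
  refine ⟨_, ⟨_, ⟨w₁, hw₁, w₂, hw₂, rfl⟩, rfl⟩, ?_⟩
  have e : (c * c) • ProjTensor.tmul w₁ w₂ = ProjTensor.tmul (c • w₁) (c • w₂) := by
    simp only [← ProjTensor.tmulL_apply, map_smul, smul_apply, smul_smul]
  change ‖_ - (c * c) • ProjTensor.tmul w₁ w₂‖ ≤ ε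
  rw [e]
  have hd0 : 0 ≤ d := by positivity
  have hd1 : 2 * d ≤ 1 := by
    rw [hd, pow_succ', mul_inv, ← mul_assoc, mul_inv_cancel₀ two_ne_zero, one_mul]
    exact inv_le_one_of_one_le₀ (one_le_pow₀ one_le_two)
  have b₁ : ‖W₁.dfjp y₁‖ ≤ ‖W₁.dfjp‖ := W₁.dfjp.unit_le_opNorm _ h₁
  have b₂ : ‖W₂.dfjp y₂‖ ≤ ‖W₂.dfjp‖ := W₂.dfjp.unit_le_opNorm _ h₂
  have bw : ‖c • w₁‖ ≤ ‖W₁.dfjp‖ + 1 := by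
    have := norm_sub_le (W₁.dfjp y₁) (W₁.dfjp y₁ - c • w₁)
    rw [sub_sub_cancel] at this
    linarith
  calc _ ≤ _ := ProjTensor.norm_tmul_sub_tmul_le _ _ _ _
    _ ≤ 2 * d * ‖W₂.dfjp‖ + (‖W₁.dfjp‖ + 1) * (2 * d) := by gcongr
    _ = d * M := by ring
    _ ≤ ε := hn.le

theorem ProjTensor.isRelWeaklyCompact_setTmul_aconv
    {X₁ : Type*} [NormedAddCommGroup X₁] [NormedSpace ℝ X₁]
    {X₂ : Type*} [NormedAddCommGroup X₂] [NormedSpace ℝ X₂]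
    {C₁ : Set X₁} {C₂ : Set X₂} (hC₁ : Bornology.IsBounded C₁) (hC₂ : Bornology.IsBounded C₂)
    (h : IsRelWeaklyCompact (setTmul C₁ C₂)) :
    IsRelWeaklyCompact (setTmul (aconv C₁ hC₁).carrier (aconv C₂ hC₂).carrier) := by
  -- Adjoining `0` to the factors adds at most the tensor `0`.
  have h0 : IsRelWeaklyCompact (setTmul (insert 0 C₁) (insert 0 C₂)) := by
    refine (h.union (.singleton 0)).mono ?_
    rintro _ ⟨x, hx | hx, y, hy | hy, rfl⟩
    · right; simp [hx, ← tmulL_apply]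
    · right; simp [hx, ← tmulL_apply]
    · right; simp [hy, ← tmulL_apply]
    · exact .inl ⟨x, hx, y, hy, rfl⟩
  refine (h0.absConvexHull (isBounded_setTmul (hC₁.insert 0) (hC₂.insert 0))).mono ?_
  rintro _ ⟨x, hx, y, hy, rfl⟩
  exact tmul_mem_absConvexHull hx hy

theorem proposition2p6
    {X₁ : Type*} [NormedAddCommGroup X₁] [NormedSpace ℝ X₁] [CompleteSpace X₁]
    {X₂ : Type*} [NormedAddCommGroup X₂] [NormedSpace ℝ X₂] [CompleteSpace X₂]
    (C₁ : Set X₁) (C₂ : Set X₂)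
    (hC₁ : Bornology.IsBounded C₁) (hC₂ : Bornology.IsBounded C₂) :
    IsWeaklyCompactOp (ProjTensor.map (aconv C₁ hC₁).dfjp (aconv C₂ hC₂).dfjp) ↔
      IsRelWeaklyCompact (ProjTensor.setTmul C₁ C₂) := by
  constructor
  · intro h
    refine IsRelWeaklyCompact.mono h ?_
    rintro _ ⟨x₁, hx₁, x₂, hx₂, rfl⟩
    obtain ⟨y₁, hy₁, rfl⟩ := (aconv C₁ hC₁).exists_dfjp_eq_of_mem
      (subset_absConvexHull (Set.mem_insert_of_mem 0 hx₁))
    obtain ⟨y₂, hy₂, rfl⟩ := (aconv C₂ hC₂).exists_dfjp_eq_of_mem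
      (subset_absConvexHull (Set.mem_insert_of_mem 0 hx₂))
    refine ⟨ProjTensor.tmul y₁ y₂, ?_, ProjTensor.map_tmul _ _ _ _⟩
    rw [mem_closedBall_zero_iff]
    exact (ProjTensor.norm_tmul_le y₁ y₂).trans (mul_le_one₀ hy₁ (norm_nonneg _) hy₂)
  · intro h
    have hQ := isRelWeaklyCompact_setTmul_dfjp _ _
      (ProjTensor.isRelWeaklyCompact_setTmul_aconv hC₁ hC₂ h)
    refine ((hQ.convexHull (ProjTensor.isBounded_setTmul ?_ ?_)).norm_closure).mono
      (ProjTensor.map_image_closedBall_subset _ _)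
    · exact (aconv C₁ hC₁).dfjp.lipschitz.isBounded_image Metric.isBounded_closedBall
    · exact (aconv C₂ hC₂).dfjp.lipschitz.isBounded_image Metric.isBounded_closedBall
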